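/- Let $p\in(0,\tfrac12)$ and consider a chain of nodes $0,1,\dots,m$ with $m\ge 1$. Node $0$ is given a uniformly distributed bit $\Theta\in\{0,1\}$. At each time $i\in\{1,\dots,n\}$, each node $j\in\{0,\dots,m-1\}$ sends one bit $X_{i,j}$ to node $j+1$ through a binary symmetric channel with crossover probability $p$, whose output is denoted $Y_{i,j}$; all channel uses are memoryless and independent. The bit $X_{i,0}$ is a function of $\Theta$ and, for $1\le j\le m-1$, the bit $X_{i,j}$ is a function of $Y_{1,j-1},\dots,Y_{i-1,j-1}$. After time $n$, node $m$ outputs an estimate $\hat\Theta\in\{0,1\}$, a function of $Y_{1,m-1},\dots,Y_{n,m-1}$. A choice of all these functions is a protocol of block length $n$. For $\varepsilon\in(0,\tfrac12)$ let $n^*_\varepsilon(m,p)$ be the smallest $n$ for which some protocol of block length $n$ satisfies $\mathbb P(\hat\Theta\ne\Theta)\le\varepsilon$ (with $n^*_\varepsilon(m,p)=\infty$ if there is none), and define the information velocity (the standard choice being $\varepsilon=\tfrac13$) by $$v_\varepsilon(p)=\limsup_{m\to\infty}\frac{m}{n^*_\varepsilon(m,p)}.$$ Then for every $\delta\in(0,1)$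 and every $\varepsilon\in(0,\tfrac12)$, $$v_\varepsilon\!\left(\tfrac{1-\delta}{2}\right)\le\delta^2 .$$ -/

import Mathlib

namespace RelayChain

/-- A protocol of block length `n` on a chain with `r` relays, that is, with `m = r + 1` hops and
nodes `0, …, r + 1`. Links are indexed by `Fin (r + 1)`: link `j` goes from node `j` to node `j + 1`.
Node `0` knows the bit `θ`; the relay indexed by `j : Fin r` is node `j + 1`, and what it sends at a
time depends only on what it received at strictly earlier times; node `r + 1` decodes after `n`
time steps. -/
structure Protocol (r n : ℕ) where
  /-- The bit that node `0` sends at time `i`. -/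
  encode : (i : Fin n) → (θ : Bool) → Bool
  /-- The bit that node `j + 1` sends at time `i`, given what it received before time `i`. -/
  relay : (j : Fin r) → (i : Fin n) → (past : Fin (i : ℕ) → Bool) → Bool
  /-- The estimate that node `r + 1` forms from the `n` bits it received. -/
  decode : (received : Fin n → Bool) → Bool

/-- Transition probability of the binary symmetric channel with crossover probability `p`. -/
noncomputable def bsc (p : ℝ) (x y : Bool) : ℝ := if y = x then 1 - p else p

namespace Protocol

variable {r n : ℕ}

/-- The bit put on link `j` at time `i`, where `y j i` is the output of link `j` at time `i`. -/
def input (P : Protocol r n) (θ : Bool) (y : Fin (r + 1) → Fin n → Bool) :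
    Fin (r + 1) → Fin n → Bool :=
  Fin.cases (fun i => P.encode i θ)
    (fun j i => P.relay j i (fun t => y j.castSucc (Fin.castLE i.isLt.le t)))

/-- The joint probability that the uniform bit equals `θ` and that the link outputs equal `y`, when
all transmissions pass through independent memoryless binary symmetric channels. -/
noncomputable def jointProb (P : Protocol r n) (p : ℝ) (θ : Bool)
    (y : Fin (r + 1) → Fin n → Bool) : ℝ :=
  1 / 2 * ∏ j, ∏ i, bsc p (P.input θ y j i) (y j i)

/-- The probability that the estimate of the last node differs from the bit. -/
noncomputable def errorProb (P : Protocol r n) (p : ℝ) : ℝ :=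
  ∑ θ : Bool, ∑ y : Fin (r + 1) → Fin n → Bool,
    if P.decode (y (Fin.last r)) ≠ θ then P.jointProb p θ y else 0

end Protocol

/-- The least block length for which some protocol with `r` relays (`r + 1` hops) has error
probability at most `ε`; it is `⊤` if there is no such block length. -/
noncomputable def minBlockLength (ε p : ℝ) (r : ℕ) : ℕ∞ :=
  sInf {N : ℕ∞ | ∃ n : ℕ, N = n ∧ ∃ P : Protocol r n, P.errorProb p ≤ ε}

open scoped ENNReal in
/-- The information velocity at error level `ε`: the upper limit of the ratio of the number `r + 1`
of hops to the least block length, as the number of hops tends to infinity. -/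
noncomputable def informationVelocity (ε p : ℝ) : ℝ≥0∞ :=
  Filter.limsup (fun r : ℕ => ((r + 1 : ℕ) : ℝ≥0∞) / (minBlockLength ε p r : ℝ≥0∞)) Filter.atTop

end RelayChain

namespace RelayChain

open Finset

/-! Let `I j i` be the chi-square information about the bit in the first `i` outputs of link `j`.
One use of a binary symmetric channel gives `I (j+1) (i+1) ≤ (1 - δ²) I (j+1) i + δ² I j i`
(`chiInfo_step`), with source information 1. So information moves no faster than a walk that
advances one link with probability `δ²` per time step, and a Chernoff bound makes it exponentially
small beyond speed `δ²` (`Strategy.pow_mul_info_le`). Error at most `ε` needs information at least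
`(1 - 2ε)²` (`Strategy.sq_le_info`). -/

/-- The chi-square information about a sign carried by an observation with law `M`, where `N u` is
the expectation of the sign on the event that the observation equals `u`. -/
noncomputable def chiInfo {U : Type*} [Fintype U] (N M : U → ℝ) : ℝ := ∑ u, N u ^ 2 / M u

/-! ### Contraction of chi-square information -/

theorem bsc_nonneg {p : ℝ} (h0 : 0 ≤ p) (h1 : p ≤ 1) (x y : Bool) : 0 ≤ bsc p x y := by
  unfold bsc; split_ifs <;> linarith

theorem sum_bsc (p : ℝ) (x : Bool) : ∑ y, bsc p x y = 1 := by
  cases x <;> simp [bsc]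

/-- The squared determinant is what is gained by distinguishing the two values. -/
theorem sq_div_add_sq_div (a b : ℝ) {A B : ℝ} (hA : 0 < A) (hB : 0 < B) :
    a ^ 2 / A + b ^ 2 / B = (a + b) ^ 2 / (A + B) + (a * B - b * A) ^ 2 / (A * B * (A + B)) := by
  field_simp
  ring

/-- Contraction of the chi-square information of one binary variable under a binary symmetric
channel. -/
theorem bsc_contraction {δ : ℝ} (h0 : 0 < δ) (h1 : δ < 1) {a b A B : ℝ} (ha : |a| ≤ A)
    (hb : |b| ≤ B) :
    ((1 + δ) / 2 * a + (1 - δ) / 2 * b) ^ 2 / ((1 + δ) / 2 * A + (1 - δ) / 2 * B) +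
      ((1 - δ) / 2 * a + (1 + δ) / 2 * b) ^ 2 / ((1 - δ) / 2 * A + (1 + δ) / 2 * B) ≤
    (1 - δ ^ 2) * ((a + b) ^ 2 / (A + B)) + δ ^ 2 * (a ^ 2 / A + b ^ 2 / B) := by
  have hA : 0 ≤ A := (abs_nonneg a).trans ha
  have hB : 0 ≤ B := (abs_nonneg b).trans hb
  have hq : 0 < 1 + δ := by linarith
  have hp : 0 < 1 - δ := by linarith
  -- If a mass vanishes, so does its signed part; with `x / 0 = 0` equality holds.
  rcases hA.eq_or_lt with rfl | hA
  · obtain rfl : a = 0 := abs_nonpos_iff.1 ha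
    rcases hB.eq_or_lt with rfl | hB
    · simp
    · apply le_of_eq
      simp only [mul_zero, zero_add]
      field_simp
      ring
  rcases hB.eq_or_lt with rfl | hB
  · obtain rfl : b = 0 := abs_nonpos_iff.1 hb
    apply le_of_eq
    simp only [mul_zero, add_zero]
    field_simp
    ring
  have hAB : 0 < A * B := mul_pos hA hB
  -- The difference is `(1 - δ²)/4 * (A - B)²`.
  have hZ : A * B ≤
      ((1 + δ) / 2 * A + (1 - δ) / 2 * B) * ((1 - δ) / 2 * A + (1 + δ) / 2 * B) := by
    nlinarith [mul_nonneg (mul_pos hq hp).le (sq_nonneg (A - B))]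
  rw [sq_div_add_sq_div _ _ (by positivity) (by positivity), sq_div_add_sq_div a b hA hB]
  have e1 : (1 + δ) / 2 * A + (1 - δ) / 2 * B + ((1 - δ) / 2 * A + (1 + δ) / 2 * B) = A + B := by
    ring
  have e2 : (1 + δ) / 2 * a + (1 - δ) / 2 * b + ((1 - δ) / 2 * a + (1 + δ) / 2 * b) = a + b := by
    ring
  -- The channel matrix has determinant `δ`, hence the factor `δ²` after squaring.
  have e3 : ((1 + δ) / 2 * a + (1 - δ) / 2 * b) * ((1 - δ) / 2 * A + (1 + δ) / 2 * B) -
      ((1 - δ) / 2 * a + (1 + δ) / 2 * b) * ((1 + δ) / 2 * A + (1 - δ) / 2 * B) =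
      δ * (a * B - b * A) := by ring
  rw [e1, e2, e3]
  have key : (δ * (a * B - b * A)) ^ 2 / (((1 + δ) / 2 * A + (1 - δ) / 2 * B) *
      ((1 - δ) / 2 * A + (1 + δ) / 2 * B) * (A + B)) ≤
      (δ * (a * B - b * A)) ^ 2 / (A * B * (A + B)) := by
    gcongr
  calc _ ≤ (a + b) ^ 2 / (A + B) + (δ * (a * B - b * A)) ^ 2 / (A * B * (A + B)) := by gcongr
    _ = _ := by ring

theorem sq_sum_le_mul_sum_sq_div {U : Type*} (s : Finset U) {N M : U → ℝ}
    (h : ∀ u ∈ s, |N u| ≤ M u) : (∑ u ∈ s, N u) ^ 2 ≤ (∑ u ∈ s, M u) * ∑ u ∈ s, N u ^ 2 / M u := by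
  have hM : ∀ u ∈ s, 0 ≤ M u := fun u hu => (abs_nonneg _).trans (h u hu)
  refine sum_sq_le_sum_mul_sum_of_sq_le_mul s hM (fun u hu => div_nonneg (sq_nonneg _) (hM u hu))
    fun u hu => ?_
  rcases (hM u hu).eq_or_lt with h0 | h0
  · have : N u = 0 := abs_nonpos_iff.1 ((h u hu).trans h0.symm.le)
    simp [this]
  · rw [mul_div_cancel₀ _ h0.ne']

/-- Data processing: merging observations loses information. -/
theorem sq_sum_div_le {U : Type*} (s : Finset U) {N M : U → ℝ} (h : ∀ u ∈ s, |N u| ≤ M u) :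
    (∑ u ∈ s, N u) ^ 2 / (∑ u ∈ s, M u) ≤ ∑ u ∈ s, N u ^ 2 / M u := by
  have hM : ∀ u ∈ s, 0 ≤ M u := fun u hu => (abs_nonneg _).trans (h u hu)
  refine div_le_of_le_mul₀ (sum_nonneg hM)
    (sum_nonneg fun u hu => div_nonneg (sq_nonneg _) (hM u hu)) ?_
  rw [mul_comm]
  exact sq_sum_le_mul_sum_sq_div s h

theorem sum_mul_bsc {U : Type*} [Fintype U] (δ : ℝ) (f : U → ℝ) (x : U → Bool) (b : Bool) :
    ∑ u, f u * bsc ((1 - δ) / 2) (x u) b =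
      (1 + δ) / 2 * (∑ u with x u = b, f u) + (1 - δ) / 2 * ∑ u with ¬ x u = b, f u := by
  rw [mul_sum, mul_sum, sum_filter, sum_filter, ← sum_add_distrib]
  refine sum_congr rfl fun u _ => ?_
  by_cases h : x u = b
  · simp only [bsc, h, if_true, not_true, if_false]; ring
  · simp only [bsc, h, Ne.symm h, if_true, not_false_eq_true, if_false]; ring

/-- Let `u` be an observation, `v` the output of a channel `K` with input `u`, and let the bit `x u`
be sent through a binary symmetric channel with output `b`. The information carried by `(v, b)`
is at most a convex combination of the information carried by `v` and the one carried by `u`. -/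
theorem chiInfo_step {U V : Type*} [Fintype U] [Fintype V] {δ : ℝ} (h0 : 0 < δ) (h1 : δ < 1)
    {N M : U → ℝ} (hNM : ∀ u, |N u| ≤ M u) {K : U → V → ℝ} (hK : ∀ u v, 0 ≤ K u v)
    (hK1 : ∀ u, ∑ v, K u v = 1) (x : U → Bool) :
    ∑ v, chiInfo (fun b => ∑ u, N u * K u v * bsc ((1 - δ) / 2) (x u) b)
      (fun b => ∑ u, M u * K u v * bsc ((1 - δ) / 2) (x u) b) ≤
    (1 - δ ^ 2) * chiInfo (fun v => ∑ u, N u * K u v) (fun v => ∑ u, M u * K u v) +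
      δ ^ 2 * chiInfo N M := by
  have habs : ∀ v u, |N u * K u v| ≤ M u * K u v := fun v u => by
    rw [abs_mul, abs_of_nonneg (hK u v)]
    exact mul_le_mul_of_nonneg_right (hNM u) (hK u v)
  -- Given `u`, the output `v` is pure noise, so `(u, v)` carries the same information as `u`.
  have hM : chiInfo N M = ∑ v, ∑ u, (N u * K u v) ^ 2 / (M u * K u v) := by
    rw [sum_comm]
    refine sum_congr rfl fun u _ => ?_
    calc N u ^ 2 / M u = ∑ v, N u ^ 2 / M u * K u v := by rw [← mul_sum, hK1, mul_one]
      _ = _ := sum_congr rfl fun v _ => by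
        rcases (hK u v).eq_or_lt with h | h
        · simp [← h]
        · rw [mul_pow, sq (K u v), mul_div_mul_comm, mul_div_assoc, div_self h.ne', mul_one]
  rw [hM]
  unfold chiInfo
  rw [mul_sum, mul_sum, ← sum_add_distrib]
  refine sum_le_sum fun v _ => ?_
  have hne : ∀ f : U → ℝ, ∑ u with ¬ x u = false, f u = ∑ u with x u = true, f u := fun f => by
    simp
  have hne' : ∀ f : U → ℝ, ∑ u with ¬ x u = true, f u = ∑ u with x u = false, f u := fun f => by
    simp
  have hsplit : ∀ f : U → ℝ, ∑ u, f u = ∑ u with x u = true, f u + ∑ u with x u = false, f u :=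
    fun f => by rw [← hne', sum_filter_add_sum_filter_not]
  simp only [sum_mul_bsc, Fintype.sum_bool, hne, hne']
  rw [hsplit (fun u => N u * K u v), hsplit (fun u => M u * K u v),
    hsplit (fun u => (N u * K u v) ^ 2 / (M u * K u v))]
  have hs : ∀ b, |∑ u with x u = b, N u * K u v| ≤ ∑ u with x u = b, M u * K u v := fun b =>
    (abs_sum_le_sum_abs _ _).trans (sum_le_sum fun u _ => habs v u)
  -- For fixed `v`, group the `u` by the bit sent; the grouping is undone by data processing.
  have := bsc_contraction h0 h1 (hs true) (hs false)
  rw [add_comm ((1 + δ) / 2 * ∑ u with x u = false, N u * K u v),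
    add_comm ((1 + δ) / 2 * ∑ u with x u = false, M u * K u v)]
  refine this.trans ?_
  gcongr
  · exact sq_sum_div_le _ fun u _ => habs v u
  · exact sq_sum_div_le _ fun u _ => habs v u

/-! ### Laws of the link outputs -/

/-- A family of encoding and relaying maps, for all times and all relays. -/
structure Strategy where
  /-- The bit that the source sends at time `i`. -/
  encode : (i : ℕ) → (θ : Bool) → Bool
  /-- The bit that relay `j` sends at time `i`. -/
  relay : (j : ℕ) → (i : ℕ) → (past : Fin i → Bool) → Bool

namespace Strategy

/-- The probability that the first `i` outputs of the first link equal `v`, given `θ`. -/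
noncomputable def sourceKernel (S : Strategy) (p : ℝ) (i : ℕ) (θ : Bool) (v : Fin i → Bool) : ℝ :=
  ∏ t : Fin i, bsc p (S.encode t θ) (v t)

/-- The probability that the first `i` outputs of the link leaving relay `j` equal `v`, given that
the relay received `u`. -/
noncomputable def relayKernel (S : Strategy) (p : ℝ) (j i : ℕ) (u v : Fin i → Bool) : ℝ :=
  ∏ t : Fin i, bsc p (S.relay j t fun s => u (Fin.castLE t.isLt.le s)) (v t)

/-- The probability that the first `i` outputs of link `j` equal `v`, given `θ`. -/
noncomputable def law (S : Strategy) (p : ℝ) : (j i : ℕ) → Bool → (Fin i → Bool) → ℝ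
  | 0, i, θ, v => S.sourceKernel p i θ v
  | j + 1, i, θ, v => ∑ u, law S p j i θ u * S.relayKernel p j i u v

theorem sum_snoc {i : ℕ} (f : (Fin (i + 1) → Bool) → ℝ) :
    ∑ w, f w = ∑ v : Fin i → Bool, ∑ b : Bool, f (Fin.snoc v b) := by
  rw [← (Fin.snocEquiv fun _ : Fin (i + 1) => Bool).sum_comp, Fintype.sum_prod_type, sum_comm]
  rfl

variable (S : Strategy) (p : ℝ)

theorem sourceKernel_snoc (i : ℕ) (θ : Bool) (v : Fin i → Bool) (b : Bool) :
    S.sourceKernel p (i + 1) θ (Fin.snoc v b) =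
      S.sourceKernel p i θ v * bsc p (S.encode i θ) b := by
  simp [sourceKernel, Fin.prod_univ_castSucc]

theorem relayKernel_snoc (j i : ℕ) (u v : Fin i → Bool) (a b : Bool) :
    S.relayKernel p j (i + 1) (Fin.snoc u a) (Fin.snoc v b) =
      S.relayKernel p j i u v * bsc p (S.relay j i u) b := by
  have h : ∀ (t : ℕ) (ht : t ≤ i) (ht' : t ≤ i + 1) (s : Fin t),
      (Fin.snoc u a : Fin (i + 1) → Bool) (Fin.castLE ht' s) = u (Fin.castLE ht s) :=
    fun t ht ht' s =>
      Fin.snoc_castSucc (α := fun _ => Bool) (x := a) (p := u) (i := Fin.castLE ht s)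
  unfold relayKernel
  rw [Fin.prod_univ_castSucc]
  congr 1
  · refine prod_congr rfl fun t _ => ?_
    simp only [Fin.snoc_castSucc]
    congr 2
    funext s
    exact h t t.isLt.le _ s
  · simp only [Fin.snoc_last]
    congr 2
    funext s
    exact h i le_rfl _ s

theorem sum_sourceKernel (i : ℕ) (θ : Bool) : ∑ v, S.sourceKernel p i θ v = 1 := by
  unfold sourceKernel
  rw [← Fintype.prod_sum]
  exact prod_eq_one fun t _ => sum_bsc p _

theorem sum_relayKernel (j i : ℕ) (u : Fin i → Bool) : ∑ v, S.relayKernel p j i u v = 1 := by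
  unfold relayKernel
  rw [← Fintype.prod_sum]
  exact prod_eq_one fun t _ => sum_bsc p _

theorem sum_law (j i : ℕ) (θ : Bool) : ∑ v, S.law p j i θ v = 1 := by
  induction j with
  | zero => exact S.sum_sourceKernel p i θ
  | succ j ih =>
    simp only [law]
    rw [sum_comm]
    simp only [← mul_sum, sum_relayKernel, mul_one, ih]

/-- The law of the outputs up to time `i + 1` has the law of the outputs up to time `i` as its
marginal. -/
theorem sum_law_snoc (j i : ℕ) (θ : Bool) (v : Fin i → Bool) :
    ∑ b : Bool, S.law p j (i + 1) θ (Fin.snoc v b) = S.law p j i θ v := by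
  induction j generalizing v with
  | zero => simp only [law, sourceKernel_snoc, ← mul_sum, sum_bsc, mul_one]
  | succ j ih =>
    simp only [law, sum_snoc, relayKernel_snoc]
    rw [sum_comm]
    refine sum_congr rfl fun u _ => ?_
    rw [sum_comm]
    simp only [← mul_sum, sum_bsc, mul_one]
    rw [← sum_mul, ih]

/-- By causality the relay's latest received symbol affects none of these outputs and sums out. -/
theorem law_succ_snoc (j i : ℕ) (θ : Bool) (v : Fin i → Bool) (b : Bool) :
    S.law p (j + 1) (i + 1) θ (Fin.snoc v b) =
      ∑ u, S.law p j i θ u * S.relayKernel p j i u v * bsc p (S.relay j i u) b := by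
  simp only [law, sum_snoc, relayKernel_snoc]
  refine sum_congr rfl fun u _ => ?_
  rw [← sum_mul, sum_law_snoc, mul_assoc]

variable {p}

theorem law_nonneg (h0 : 0 ≤ p) (h1 : p ≤ 1) (j i : ℕ) (θ : Bool) (v : Fin i → Bool) :
    0 ≤ S.law p j i θ v := by
  induction j generalizing v with
  | zero =>
    rw [law, sourceKernel]
    exact prod_nonneg fun t _ => bsc_nonneg h0 h1 _ _
  | succ j ih =>
    exact sum_nonneg fun u _ => mul_nonneg (ih u) (prod_nonneg fun t _ => bsc_nonneg h0 h1 _ _)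

/-! ### Recursion for the information and its Chernoff bound -/

variable (p)

/-- The probability that the first `i` outputs of link `j` equal `v`. -/
noncomputable def mean (j i : ℕ) (v : Fin i → Bool) : ℝ :=
  (S.law p j i true v + S.law p j i false v) / 2

/-- The expectation of the sign of the source bit, on the event that the first `i` outputs of link
`j` equal `v`. -/
noncomputable def gap (j i : ℕ) (v : Fin i → Bool) : ℝ :=
  (S.law p j i true v - S.law p j i false v) / 2

/-- The information about the source bit carried by the first `i` outputs of link `j`. -/
noncomputable def info (j i : ℕ) : ℝ := chiInfo (S.gap p j i) (S.mean p j i)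

variable {p}

theorem abs_gap_le_mean (h0 : 0 ≤ p) (h1 : p ≤ 1) (j i : ℕ) (v : Fin i → Bool) :
    |S.gap p j i v| ≤ S.mean p j i v := by
  have ht := S.law_nonneg h0 h1 j i true v
  have hf := S.law_nonneg h0 h1 j i false v
  unfold gap mean
  rw [abs_le]
  constructor <;> linarith

theorem info_time_zero (j : ℕ) : S.info p j 0 = 0 := by
  have h : ∀ θ v, S.law p j 0 θ v = 1 := fun θ v => by
    have := S.sum_law p j 0 θ
    rw [Fintype.sum_unique] at this
    convert this
  simp [info, chiInfo, gap, h]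

/-- The source acts as a relay observing `θ` itself, whose information is 1. -/
theorem info_source_step {δ : ℝ} (h0 : 0 < δ) (h1 : δ < 1) (i : ℕ) :
    S.info ((1 - δ) / 2) 0 (i + 1) ≤ (1 - δ ^ 2) * S.info ((1 - δ) / 2) 0 i + δ ^ 2 := by
  have h := chiInfo_step (N := fun θ : Bool => if θ then 1 / 2 else -(1 / 2))
    (M := fun _ => 1 / 2) h0 h1 (fun θ => by cases θ <;> norm_num [abs_of_pos])
    (K := S.sourceKernel ((1 - δ) / 2) i)
    (fun u v => prod_nonneg fun t _ => bsc_nonneg (by linarith) (by linarith) _ _)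
    (S.sum_sourceKernel _ i) (S.encode i)
  have h2 : chiInfo (fun θ : Bool => if θ then (1 : ℝ) / 2 else -(1 / 2)) (fun _ => 1 / 2) = 1 := by
    norm_num [chiInfo]
  rw [h2, mul_one] at h
  convert h using 1
  · simp only [info, chiInfo, sum_snoc, gap, mean, law, sourceKernel_snoc]
    refine sum_congr rfl fun v _ => sum_congr rfl fun b _ => ?_
    simp only [Fintype.sum_bool, if_true, Bool.false_eq_true, if_false]
    congr 1 <;> ring
  · congr 2
    simp only [info, chiInfo, gap, mean, law]
    refine sum_congr rfl fun v _ => ?_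
    simp only [Fintype.sum_bool, if_true, Bool.false_eq_true, if_false]
    congr 1 <;> ring

theorem info_relay_step {δ : ℝ} (h0 : 0 < δ) (h1 : δ < 1) (j i : ℕ) :
    S.info ((1 - δ) / 2) (j + 1) (i + 1) ≤
      (1 - δ ^ 2) * S.info ((1 - δ) / 2) (j + 1) i + δ ^ 2 * S.info ((1 - δ) / 2) j i := by
  have h := chiInfo_step h0 h1
    (S.abs_gap_le_mean (p := (1 - δ) / 2) (by linarith) (by linarith) j i)
    (K := S.relayKernel ((1 - δ) / 2) j i)
    (fun u v => prod_nonneg fun t _ => bsc_nonneg (by linarith) (by linarith) _ _)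
    (S.sum_relayKernel _ j i) (S.relay j i)
  convert h using 1
  · rw [info, chiInfo, sum_snoc]
    refine sum_congr rfl fun v _ => sum_congr rfl fun b _ => ?_
    simp only [gap, mean, law_succ_snoc]
    rw [← sum_sub_distrib, ← sum_add_distrib, sum_div, sum_div]
    congr 1
    · congr 1
      exact sum_congr rfl fun u _ => by ring
    · exact sum_congr rfl fun u _ => by ring
  · congr 2
    rw [info, chiInfo]
    refine sum_congr rfl fun v _ => ?_
    simp only [gap, mean, law]
    rw [← sum_sub_distrib, ← sum_add_distrib, sum_div, sum_div]
    congr 1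
    · congr 1
      exact sum_congr rfl fun u _ => by ring
    · exact sum_congr rfl fun u _ => by ring

/-- An exponential bound on the information that reaches the end of link `j` by time `i`. -/
theorem pow_mul_info_le {δ c : ℝ} (h0 : 0 < δ) (h1 : δ < 1) (hc : 1 ≤ c) (j i : ℕ) :
    c ^ (j + 1) * S.info ((1 - δ) / 2) j i ≤ (1 + δ ^ 2 * (c - 1)) ^ i := by
  have hδ : 0 ≤ 1 - δ ^ 2 := by nlinarith
  have hbase : 1 ≤ 1 + δ ^ 2 * (c - 1) := by
    have := mul_nonneg (sq_nonneg δ) (sub_nonneg.2 hc)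
    linarith
  induction i generalizing j with
  | zero => simp [info_time_zero]
  | succ i ih =>
    -- The base is the generating function at `c` of a Bernoulli variable with mean `δ²`.
    have e : (1 + δ ^ 2 * (c - 1)) ^ (i + 1) = (1 - δ ^ 2) * (1 + δ ^ 2 * (c - 1)) ^ i +
        δ ^ 2 * c * (1 + δ ^ 2 * (c - 1)) ^ i := by ring
    have hc' : 0 ≤ δ ^ 2 * c := by positivity
    rw [e]
    cases j with
    | zero =>
      calc c ^ (0 + 1) * S.info ((1 - δ) / 2) 0 (i + 1)
          ≤ c ^ (0 + 1) * ((1 - δ ^ 2) * S.info ((1 - δ) / 2) 0 i + δ ^ 2) := by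
            gcongr
            exact S.info_source_step h0 h1 i
        _ = (1 - δ ^ 2) * (c ^ (0 + 1) * S.info ((1 - δ) / 2) 0 i) + δ ^ 2 * c * 1 := by ring
        _ ≤ _ := by
          gcongr
          · exact ih 0
          · exact one_le_pow₀ hbase
    | succ j =>
      calc c ^ (j + 1 + 1) * S.info ((1 - δ) / 2) (j + 1) (i + 1)
          ≤ c ^ (j + 1 + 1) * ((1 - δ ^ 2) * S.info ((1 - δ) / 2) (j + 1) i +
              δ ^ 2 * S.info ((1 - δ) / 2) j i) := by
            gcongr
            exact S.info_relay_step h0 h1 j i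
        _ = (1 - δ ^ 2) * (c ^ (j + 1 + 1) * S.info ((1 - δ) / 2) (j + 1) i) +
              δ ^ 2 * c * (c ^ (j + 1) * S.info ((1 - δ) / 2) j i) := by ring
        _ ≤ _ := by
          gcongr
          · exact ih (j + 1)
          · exact ih j

/-- A decoder with small error probability witnesses a large information. -/
theorem sq_le_info {n : ℕ} {ε : ℝ} (h0 : 0 ≤ p) (h1 : p ≤ 1) (hε : ε ≤ 1 / 2) (r : ℕ)
    (dec : (Fin n → Bool) → Bool)
    (h : ∑ θ : Bool, ∑ v, (if dec v ≠ θ then 1 / 2 * S.law p r n θ v else 0) ≤ ε) :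
    (1 - 2 * ε) ^ 2 ≤ S.info p r n := by
  have hmean : ∑ v, S.mean p r n v = 1 := by
    simp only [mean]
    rw [← sum_div, sum_add_distrib, sum_law, sum_law]
    norm_num
  -- Both sides are the correlation between the signs of the bit and of its estimate.
  have e : 1 - 2 * ∑ θ : Bool, ∑ v, (if dec v ≠ θ then 1 / 2 * S.law p r n θ v else 0) =
      ∑ v, (if dec v then S.gap p r n v else - S.gap p r n v) := by
    rw [Fintype.sum_bool, ← sum_add_distrib, mul_sum, sub_eq_iff_eq_add, ← sum_add_distrib]
    refine hmean.symm.trans ?_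
    refine sum_congr rfl fun v _ => ?_
    cases dec v <;> simp [mean, gap] <;> ring
  have hcs := sq_sum_le_mul_sum_sq_div univ
    (N := fun v => if dec v then S.gap p r n v else - S.gap p r n v) (M := S.mean p r n)
    fun v _ => by
      have := S.abs_gap_le_mean h0 h1 r n v
      split_ifs
      · exact this
      · rwa [abs_neg]
  rw [hmean, one_mul, ← e] at hcs
  have hinfo : ∑ v, (if dec v then S.gap p r n v else - S.gap p r n v) ^ 2 / S.mean p r n v =
      S.info p r n := by
    refine sum_congr rfl fun v _ => ?_
    split_ifs <;> simp
  rw [hinfo] at hcs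
  refine le_trans ?_ hcs
  have : 0 ≤ 1 - 2 * ε := by linarith
  gcongr

/-! ### From the joint law of a protocol to link laws -/

/-- The bit put on link `j` at time `i`, where `y j i` is the output of link `j` at time `i`. -/
def input {k n : ℕ} (θ : Bool) (y : Fin (k + 1) → Fin n → Bool) : Fin (k + 1) → Fin n → Bool :=
  Fin.cases (fun i => S.encode i θ)
    (fun j i => S.relay j i (fun t => y j.castSucc (Fin.castLE i.isLt.le t)))

theorem input_snoc_castSucc {k n : ℕ} (θ : Bool) (y : Fin (k + 1) → Fin n → Bool)
    (v : Fin n → Bool) (j : Fin (k + 1)) :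
    S.input θ (Fin.snoc y v : Fin (k + 2) → Fin n → Bool) j.castSucc = S.input θ y j := by
  induction j using Fin.cases with
  | zero => rfl
  | succ j =>
    rw [← Fin.succ_castSucc]
    funext i
    simp only [input, Fin.cases_succ, Fin.snoc_castSucc, Fin.val_castSucc]

theorem input_snoc_last {k n : ℕ} (θ : Bool) (y : Fin (k + 1) → Fin n → Bool)
    (v : Fin n → Bool) (i : Fin n) :
    S.input θ (Fin.snoc y v : Fin (k + 2) → Fin n → Bool) (Fin.last (k + 1)) i =
      S.relay k i fun t => y (Fin.last k) (Fin.castLE i.isLt.le t) := by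
  rw [← Fin.succ_last]
  simp only [input, Fin.cases_succ, Fin.snoc_castSucc, Fin.val_last]

/-- Summing the joint law of all link outputs over all but the last link. -/
theorem sum_prod_bsc_input (p : ℝ) {n : ℕ} (k : ℕ) (θ : Bool) (F : (Fin n → Bool) → ℝ) :
    ∑ y : Fin (k + 1) → Fin n → Bool,
        F (y (Fin.last k)) * ∏ j, ∏ i, bsc p (S.input θ y j i) (y j i) =
      ∑ v, F v * S.law p k n θ v := by
  induction k generalizing F with
  | zero =>
    rw [← (Equiv.funUnique (Fin 1) (Fin n → Bool)).symm.sum_comp]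
    refine sum_congr rfl fun v _ => ?_
    simp [law, sourceKernel, input]
  | succ k ih =>
    rw [← (Fin.snocEquiv fun _ : Fin (k + 2) => Fin n → Bool).sum_comp, Fintype.sum_prod_type]
    refine sum_congr rfl fun v _ => ?_
    rw [law, mul_sum]
    -- The last link is absorbed into the test function, so `F` must be arbitrary.
    have := ih fun u => F v * S.relayKernel p k n u v
    calc _ = ∑ y : Fin (k + 1) → Fin n → Bool, F v * S.relayKernel p k n (y (Fin.last k)) v *
          ∏ j, ∏ i, bsc p (S.input θ y j i) (y j i) := by
          refine sum_congr rfl fun y _ => ?_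
          change F ((Fin.snoc y v : Fin (k + 2) → Fin n → Bool) _) * ∏ j, ∏ i,
            bsc p (S.input θ (Fin.snoc y v : Fin (k + 2) → Fin n → Bool) j i)
              ((Fin.snoc y v : Fin (k + 2) → Fin n → Bool) j i) = _
          rw [Fin.prod_univ_castSucc]
          simp only [input_snoc_castSucc, input_snoc_last, Fin.snoc_castSucc, Fin.snoc_last]
          rw [relayKernel]
          ring
      _ = _ := by
        rw [this]
        exact sum_congr rfl fun u _ => by ring

end Strategy

namespace Protocol

variable {r n : ℕ}

/-- A protocol, continued by constant maps beyond its relays and its block length. -/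
def toStrategy (P : Protocol r n) : Strategy where
  encode i θ := if h : i < n then P.encode ⟨i, h⟩ θ else false
  relay j i past := if h : j < r ∧ i < n then P.relay ⟨j, h.1⟩ ⟨i, h.2⟩ past else false

theorem input_toStrategy (P : Protocol r n) (θ : Bool) (y : Fin (r + 1) → Fin n → Bool) :
    P.toStrategy.input θ y = P.input θ y := by
  funext j i
  induction j using Fin.cases with
  | zero => simp [Strategy.input, input, toStrategy]
  | succ j => simp [Strategy.input, input, toStrategy]

theorem errorProb_eq (P : Protocol r n) (p : ℝ) :
    P.errorProb p = ∑ θ : Bool, ∑ v,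
      (if P.decode v ≠ θ then 1 / 2 * P.toStrategy.law p r n θ v else 0) := by
  refine sum_congr rfl fun θ _ => ?_
  have := P.toStrategy.sum_prod_bsc_input p r θ
    fun v => if P.decode v ≠ θ then (1 / 2 : ℝ) else 0
  simp only [ite_mul, zero_mul, input_toStrategy] at this
  exact this

theorem pow_mul_sq_le (P : Protocol r n) {δ ε c : ℝ} (h0 : 0 < δ) (h1 : δ < 1) (hε : ε ≤ 1 / 2)
    (hc : 1 ≤ c) (h : P.errorProb ((1 - δ) / 2) ≤ ε) :
    c ^ (r + 1) * (1 - 2 * ε) ^ 2 ≤ (1 + δ ^ 2 * (c - 1)) ^ n := by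
  rw [errorProb_eq] at h
  refine le_trans ?_ (P.toStrategy.pow_mul_info_le h0 h1 hc r n)
  gcongr
  exact P.toStrategy.sq_le_info (by linarith) (by linarith) hε r _ h

end Protocol

/-! ### Asymptotics in the number of hops -/

/-- For `c > δ ^ 2` and a large number of hops, reliable protocols have block length at least the
number of hops divided by `c`. -/
theorem eventually_hops_le {δ ε c : ℝ} (h0 : 0 < δ) (h1 : δ < 1) (hε : ε < 1 / 2)
    (hc : δ ^ 2 < c) : ∀ᶠ r : ℕ in Filter.atTop, ∀ n : ℕ, ∀ P : Protocol r n,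
      P.errorProb ((1 - δ) / 2) ≤ ε → ((r + 1 : ℕ) : ℝ) ≤ c * n := by
  have hδ2 : 0 < δ ^ 2 := by positivity
  have hcpos : 0 < c := hδ2.trans hc
  -- This `l` minimises `exp (δ² (l - 1) n) / l ^ (r + 1)` at the critical length `n = (r + 1) / c`.
  obtain ⟨l, hl⟩ : ∃ l, l = c / δ ^ 2 := ⟨_, rfl⟩
  have hl1 : 1 < l := by rwa [hl, one_lt_div hδ2]
  have hlpos : 0 < l := by linarith
  have hexp : Real.exp (1 - l⁻¹) < l := by
    have hlt : l⁻¹ < 1 := inv_lt_one_of_one_lt₀ hl1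
    have h : l⁻¹ < Real.exp (l⁻¹ - 1) := by
      have := Real.add_one_lt_exp (x := l⁻¹ - 1) (by linarith)
      linarith
    have := inv_lt_of_inv_lt₀ hlpos h
    rwa [← Real.exp_neg, neg_sub] at this
  have hq0 : 0 ≤ Real.exp (1 - l⁻¹) / l := by positivity
  have hq1 : Real.exp (1 - l⁻¹) / l < 1 := (div_lt_one hlpos).2 hexp
  have hpos : 0 < (1 - 2 * ε) ^ 2 := by
    have : 0 < 1 - 2 * ε := by linarith
    positivity
  have hlim := (tendsto_pow_atTop_nhds_zero_of_lt_one hq0 hq1).comp (Filter.tendsto_add_atTop_nat 1)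
  filter_upwards [hlim.eventually_lt_const hpos] with r hr n P hP
  by_contra! hn
  have key := P.pow_mul_sq_le h0 h1 hε.le hl1.le hP
  have hexpo : (1 + δ ^ 2 * (l - 1)) ^ n ≤ Real.exp (1 - l⁻¹) ^ (r + 1) := by
    calc (1 + δ ^ 2 * (l - 1)) ^ n ≤ Real.exp (δ ^ 2 * (l - 1)) ^ n := by
          have := mul_nonneg hδ2.le (sub_nonneg.2 hl1.le)
          gcongr
          linarith [Real.add_one_le_exp (δ ^ 2 * (l - 1))]
      _ = Real.exp ((1 - l⁻¹) * (c * n)) := by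
          rw [← Real.exp_nat_mul]
          congr 1
          rw [hl]
          field_simp
      _ ≤ Real.exp ((1 - l⁻¹) * (r + 1 : ℕ)) := by
          have : 0 ≤ 1 - l⁻¹ := sub_nonneg.2 (inv_le_one_of_one_le₀ hl1.le)
          gcongr
      _ = _ := by rw [← Real.exp_nat_mul, mul_comm]
  simp only [Function.comp_apply, div_pow] at hr
  rw [div_lt_iff₀ (by positivity)] at hr
  linarith [key.trans hexpo, mul_comm (l ^ (r + 1)) ((1 - 2 * ε) ^ 2)]

end RelayChain

theorem proposition1 (δ : ℝ) (hδ0 : 0 < δ) (hδ1 : δ < 1) (ε : ℝ) (hε0 : 0 < ε) (hε1 : ε < 1 / 2) :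
    RelayChain.informationVelocity ε ((1 - δ) / 2) ≤ ENNReal.ofReal (δ ^ 2) := by
  refine le_of_forall_gt_imp_ge_of_dense fun C hC => ?_
  rcases eq_or_ne C ⊤ with rfl | hCtop
  · exact le_top
  obtain ⟨c, hc⟩ : ∃ c, c = C.toReal := ⟨_, rfl⟩
  have hCc : C = ENNReal.ofReal c := by rw [hc, ENNReal.ofReal_toReal hCtop]
  have hδc : δ ^ 2 < c := by
    rw [hc]
    exact (ENNReal.ofReal_lt_iff_lt_toReal (by positivity) hCtop).1 hC
  have hcpos : 0 < c := lt_of_le_of_lt (sq_nonneg δ) hδc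
  refine Filter.limsup_le_of_le (h := ?_)
  filter_upwards [RelayChain.eventually_hops_le hδ0 hδ1 hε1 hδc] with r hr
  refine ENNReal.div_le_of_le_mul ?_
  -- Without a reliable protocol the block length is `⊤`, and `C * ⊤ = ⊤` since `C ≠ 0`; otherwise
  -- the infimum is attained.
  rcases Set.eq_empty_or_nonempty
    {N : ℕ∞ | ∃ n : ℕ, N = n ∧ ∃ P : RelayChain.Protocol r n, P.errorProb ((1 - δ) / 2) ≤ ε} with
    he | hne
  · have : C ≠ 0 := by rw [hCc]; simpa using hcpos
    rw [RelayChain.minBlockLength, he, sInf_empty, ENat.toENNReal_top, ENNReal.mul_top this]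
    exact le_top
  · obtain ⟨n, hn, P, hP⟩ := csInf_mem hne
    rw [RelayChain.minBlockLength, hn, ENat.toENNReal_coe, hCc, ← ENNReal.ofReal_natCast,
      ← ENNReal.ofReal_natCast n, ← ENNReal.ofReal_mul hcpos.le]
    exact ENNReal.ofReal_le_ofReal (hr n P hP)
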